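/- Let $F$ be a field. An affine variety $V\subseteq\mathbb A^n$ defined by an ideal $I\subseteq F[x_1,\dots,x_n]$ is called absolutely irreducible (over $F$) if $I$ generates a prime ideal in $\overline F[x_1,\dots,x_n]$, where $\overline F$ is an algebraic closure of $F$. A $K$-rational point of $V$, for a field $K\supseteq F$, is called simple if $V$ is smooth over $F$ at it. The field $F$ is pseudo-algebraically closed (PAC) if every absolutely irreducible affine variety defined over $F$ has an $F$-rational point. The field $F$ is pseudo real closed (PRC) if every absolutely irreducible affine variety defined over $F$ that has a simple $K$-rational point for every real closed field $K\supseteq F$ has an $F$-rational point. **Lemma.** Let $F$ be a PRC field, let $D$ be a real closure of $F$ (a real closed field that is an algebraic extension of $F$), and let $i=\sqrt{-1}$, that is, an element $i$ of some extension field of $D$ with $i^2=-1$. Then $F(i)$ is a perfect PAC field, and $D(i)$ is an algebraic closure of $F(i)$. -/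

import Mathlib

open IntermediateField

universe u v

/-- The affine scheme `V(I) ⊆ 𝔸ⁿ` cut out by an ideal `I` of `F[x₁, …, xₙ]` is an absolutely
irreducible variety defined over `F`: the ideal generated by `I` in `F̄[x₁, …, xₙ]` is prime, where
`F̄` is an algebraic closure of `F`. In particular such a variety is not empty. -/
def IsAbsIrreducible {F : Type u} [Field F] {n : ℕ} (I : Ideal (MvPolynomial (Fin n) F)) : Prop :=
  (I.map (MvPolynomial.map (algebraMap F (AlgebraicClosure F)))).IsPrime

/-- `x ∈ Kⁿ` is a simple (that is, nonsingular) `K`-rational point of the affine variety `V(I)`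
over `F`: it is a zero of `I`, and `F[x₁, …, xₙ] / I` is smooth over `F` at the prime ideal of the
functions that vanish at `x`. Smoothness over the base field does not change under extension of the
base field, so this says the same as smoothness of `V(I)` over `K` at `x`. -/
def IsSimplePoint {F : Type u} [Field F] {n : ℕ} (I : Ideal (MvPolynomial (Fin n) F))
    {K : Type v} [Field K] [Algebra F K] (x : Fin n → K) : Prop :=
  ∃ hx : x ∈ MvPolynomial.zeroLocus K I,
    (⟨RingHom.ker (Ideal.Quotient.liftₐ I (MvPolynomial.aeval x) hx), RingHom.ker_isPrime _⟩ :
      PrimeSpectrum (MvPolynomial (Fin n) F ⧸ I)) ∈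
        Algebra.smoothLocus F (MvPolynomial (Fin n) F ⧸ I)

/-- `F` is pseudo-algebraically closed: every absolutely irreducible affine variety defined over
`F` has an `F`-rational point. -/
def IsPAC (F : Type u) [Field F] : Prop :=
  ∀ (n : ℕ) (I : Ideal (MvPolynomial (Fin n) F)), IsAbsIrreducible I →
    (MvPolynomial.zeroLocus F I).Nonempty

/-- `F` is pseudo real closed, in the sense of Prestel: every absolutely irreducible affine variety
defined over `F` that has a simple `K`-rational point for every real closed field `K` containing
`F` has an `F`-rational point. -/
def IsPRC (F : Type u) [Field F] : Prop :=
  ∀ (n : ℕ) (I : Ideal (MvPolynomial (Fin n) F)), IsAbsIrreducible I →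
    (∀ (K : Type u) [Field K] [Algebra F K] [IsRealClosed K],
      ∃ x : Fin n → K, IsSimplePoint I x) →
    (MvPolynomial.zeroLocus F I).Nonempty

/-- The condition obtained by dropping the word "simple" implies that `F` is pseudo real closed. -/
theorem IsPRC.of_rational_points {F : Type u} [Field F]
    (h : ∀ (n : ℕ) (I : Ideal (MvPolynomial (Fin n) F)), IsAbsIrreducible I →
      (∀ (K : Type u) [Field K] [Algebra F K] [IsRealClosed K],
        (MvPolynomial.zeroLocus K I).Nonempty) →
      (MvPolynomial.zeroLocus F I).Nonempty) : IsPRC F := by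
  intro n I hI hK
  refine h n I hI ?_
  intro K _ _ _
  obtain ⟨x, hx, _⟩ := hK K
  exact ⟨x, hx⟩

theorem isTorsionFree_of_fields (E : Type u) (K : Type v) [Field E] [Field K] [Algebra E K] :
    Module.IsTorsionFree E K := inferInstance

/-- A shortcut: the direct search for this instance runs out of time. -/
instance isTorsionFree_intermediateField {F : Type u} {C : Type v} [Field F] [Field C]
    [Algebra F C] (E : IntermediateField F C) (L : IntermediateField E C) :
    Module.IsTorsionFree E L := isTorsionFree_of_fields E L

/-! The field `F` lies in the real closed field `D`, so it is formally real and has characteristic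
zero. Hence -1 is not a square in `F` or in `D`, and `AdjoinI` is a concrete model of both `F(i)`
and `D(i)`. Perfectness is then automatic, and `D(i)` is algebraically closed by the Artin–Schreier
argument: odd degree polynomials over `D` have roots, and every element of `D(i)` is a square.

The PAC property comes from Weil restriction. A geometrically integral variety over `F(i)` may be
shrunk to a smooth affine open piece, with coordinate ring `A`. Its Weil restriction `B` has as
`C`-points the `C[i]`-points of `A`, for each `F`-algebra `C`. It is smooth because infinitesimal
lifting passes through this correspondence (`IsWeilRestriction.formallySmooth`). It is geometrically
integral because over the algebraic closure of `F` it becomes a product of two conjugate copies of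
the variety (`IsWeilRestriction.isDomain`).

If `K` is a real closed extension of `F`, then `K[i]` is algebraically closed, so `A` has a
`K[i]`-point by the Nullstellensatz and `B` has a `K`-point, which is simple. The PRC property now
gives an `F`-point of `B`, which is an `F(i)`-point of `A`. -/

open scoped TensorProduct

/-! ### The Artin–Schreier criterion for algebraic closedness -/

/-- A field of characteristic zero in which every element is a square has no quadratic
extension. -/
theorem finrank_ne_two_of_forall_isSquare {L N : Type*} [Field L] [Field N] [Algebra L N]
    [CharZero L] (hL : ∀ x : L, IsSquare x) : Module.finrank L N ≠ 2 := by
  intro h2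
  have hfin : FiniteDimensional L N := Module.finite_of_finrank_pos (by omega)
  obtain ⟨α, hα⟩ := Field.exists_primitive_element L N
  have hdeg := (Field.primitive_element_iff_minpoly_natDegree_eq L α).1 hα
  have hint : IsIntegral L α := IsIntegral.of_finite L α
  set p := minpoly L α with hp
  have hirr : Irreducible p := minpoly.irreducible hint
  have hd : p.natDegree = 2 := by rw [hdeg, h2]
  obtain ⟨s, hs⟩ := hL (discrim (p.coeff 2) (p.coeff 1) (p.coeff 0))
  have hlead : p.coeff 2 = 1 := by
    have := (minpoly.monic hint).coeff_natDegree
    rwa [← hp, hd] at this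
  obtain ⟨x, hx⟩ := exists_quadratic_eq_zero (a := p.coeff 2) (b := p.coeff 1) (c := p.coeff 0)
    (by simp [hlead]) ⟨s, hs⟩
  have hroot : p.IsRoot x := by
    rw [Polynomial.IsRoot, Polynomial.eval_eq_sum_range, hd]
    simp only [Finset.sum_range_succ, Finset.sum_range_zero]
    linear_combination hx
  have h1 := Polynomial.natDegree_eq_of_degree_eq_some
    (Polynomial.degree_eq_one_of_irreducible_of_root hirr hroot)
  exact absurd (hd.symm.trans h1) (by norm_num)

theorem finrank_eq_one_of_odd {R N : Type*} [Field R] [Field N] [Algebra R N] [CharZero R]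
    (hR : ∀ f : Polynomial R, Odd f.natDegree → ∃ x, f.IsRoot x)
    (hN : Odd (Module.finrank R N)) : Module.finrank R N = 1 := by
  have hfin : FiniteDimensional R N := Module.finite_of_finrank_pos hN.pos
  obtain ⟨α, hα⟩ := Field.exists_primitive_element R N
  have hdeg := (Field.primitive_element_iff_minpoly_natDegree_eq R α).1 hα
  obtain ⟨x, hx⟩ := hR (minpoly R α) (by rwa [hdeg])
  rw [← hdeg]
  exact Polynomial.natDegree_eq_of_degree_eq_some
    (Polynomial.degree_eq_one_of_irreducible_of_root
      (minpoly.irreducible (IsIntegral.of_finite R α)) hx)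

/-- A Galois extension of a field all of whose odd degree polynomials have a root has degree a
power of two. -/
theorem exists_finrank_eq_two_pow {R N : Type*} [Field R] [Field N] [Algebra R N] [CharZero R]
    [FiniteDimensional R N] [IsGalois R N]
    (hR : ∀ f : Polynomial R, Odd f.natDegree → ∃ x, f.IsRoot x) :
    ∃ k, Module.finrank R N = 2 ^ k := by
  have : Fact (Nat.Prime 2) := ⟨Nat.prime_two⟩
  let P : Sylow 2 (N ≃ₐ[R] N) := default
  have hmul := Module.finrank_mul_finrank R (fixedField (P : Subgroup (N ≃ₐ[R] N))) N
  rw [IntermediateField.finrank_fixedField_eq_card, ← IsGalois.card_aut_eq_finrank R N,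
    ← Subgroup.card_mul_index (P : Subgroup (N ≃ₐ[R] N)), mul_comm] at hmul
  have hidx := Nat.eq_of_mul_eq_mul_left Nat.card_pos hmul
  -- The degree of the fixed field is the index of a Sylow 2-subgroup, so this field is trivial and
  -- the whole group is a 2-group.
  have hodd : Odd (Module.finrank R (fixedField (P : Subgroup (N ≃ₐ[R] N)))) := by
    rw [hidx]
    exact Nat.odd_iff.2 (by have := P.not_dvd_index; omega)
  have h1 := finrank_eq_one_of_odd hR hodd
  rw [← Module.finrank_mul_finrank R (fixedField (P : Subgroup (N ≃ₐ[R] N))) N, h1, one_mul,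
    IntermediateField.finrank_fixedField_eq_card]
  exact ⟨_, P.card_eq_multiplicity⟩

/-- A nontrivial 2-group has a subgroup of index two, whose fixed field would be a quadratic
extension of `L`. -/
theorem finrank_eq_one_of_eq_two_pow {L N : Type*} [Field L] [Field N] [Algebra L N] [CharZero L]
    [FiniteDimensional L N] [IsGalois L N] (hL : ∀ x : L, IsSquare x) {k : ℕ}
    (hk : Module.finrank L N = 2 ^ k) : Module.finrank L N = 1 := by
  have : Fact (Nat.Prime 2) := ⟨Nat.prime_two⟩
  cases k with
  | zero => simpa using hk
  | succ k =>
    have hcard : Nat.card (N ≃ₐ[L] N) = 2 ^ (k + 1) := by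
      rw [IsGalois.card_aut_eq_finrank, hk]
    obtain ⟨H, hH⟩ := Sylow.exists_subgroup_card_pow_prime (G := N ≃ₐ[L] N) 2 (n := k)
      (by rw [hcard]; exact pow_dvd_pow _ (Nat.le_succ k))
    have hmul := Module.finrank_mul_finrank L (fixedField H) N
    rw [IntermediateField.finrank_fixedField_eq_card, hH, hk, pow_succ, mul_comm] at hmul
    exact absurd (Nat.eq_of_mul_eq_mul_left (by positivity) hmul)
      (finrank_ne_two_of_forall_isSquare hL)

/-- A criterion for algebraic closedness, in the form used by Artin and Schreier. -/
theorem isAlgClosed_of_odd_root_of_isSquare {R L : Type*} [Field R] [Field L] [Algebra R L]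
    [CharZero R] [FiniteDimensional R L]
    (hR : ∀ f : Polynomial R, Odd f.natDegree → ∃ x, f.IsRoot x)
    (hL : ∀ x : L, IsSquare x) : IsAlgClosed L := by
  have : CharZero L := charZero_of_injective_algebraMap (algebraMap R L).injective
  refine IsAlgClosed.of_exists_root L fun p _ hirr => ?_
  let Ω := AlgebraicClosure L
  obtain ⟨α, hα⟩ := IsAlgClosed.exists_aeval_eq_zero Ω p
    (Polynomial.degree_pos_of_irreducible hirr).ne'
  have : FiniteDimensional L L⟮α⟯ :=
    adjoin.finiteDimensional (Algebra.IsIntegral.isIntegral α)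
  have : FiniteDimensional R L⟮α⟯ := FiniteDimensional.trans R L L⟮α⟯
  let E : IntermediateField R Ω := L⟮α⟯.restrictScalars R
  have : FiniteDimensional R E := ‹FiniteDimensional R L⟮α⟯›
  have : Algebra.IsAlgebraic R Ω := Algebra.IsAlgebraic.trans R L Ω
  -- The closure is taken over `R`, not `L`: the Sylow argument uses the odd degree hypothesis on
  -- `R`, and the degree over `L` divides the degree over `R`.
  let N : IntermediateField R Ω := normalClosure R E Ω
  have hEN : E ≤ N := IntermediateField.le_normalClosure E
  have : IsAlgClosure R Ω := ⟨inferInstance, inferInstance⟩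
  have hnormal : Normal R Ω := IsAlgClosure.normal R Ω
  have : Normal R N := inferInstanceAs (Normal R (normalClosure R E Ω))
  have : FiniteDimensional R N := normalClosure.is_finiteDimensional R E Ω
  have : IsGalois R N := ⟨⟩
  let φ : L →ₐ[R] N := (IsScalarTower.toAlgHom R L Ω).codRestrict N.toSubalgebra
    (fun x => hEN (L⟮α⟯.algebraMap_mem x))
  let _ : Algebra L N := φ.toRingHom.toAlgebra
  have : IsScalarTower R L N := IsScalarTower.of_algebraMap_eq' φ.comp_algebraMap.symm
  have : IsScalarTower L N Ω := IsScalarTower.of_algebraMap_eq' rfl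
  have : IsGalois L N := IsGalois.tower_top_of_isGalois R L N
  have : FiniteDimensional L N := FiniteDimensional.right R L N
  obtain ⟨k, hk⟩ := exists_finrank_eq_two_pow (N := N) hR
  rw [← Module.finrank_mul_finrank R L N] at hk
  obtain ⟨m, -, hm⟩ := (Nat.dvd_prime_pow Nat.prime_two).1 (hk ▸ Dvd.intro_left _ rfl)
  have h1 := finrank_eq_one_of_eq_two_pow hL hm
  have hαN : α ∈ N := hEN (mem_adjoin_simple_self L α)
  obtain ⟨x, hx⟩ := (Algebra.finrank_eq_one_iff_bijective_algebraMap.1 h1).2 ⟨α, hαN⟩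
  refine ⟨x, (algebraMap L Ω).injective ?_⟩
  have hx' : algebraMap L Ω x = α := congrArg Subtype.val hx
  rw [← hx'] at hα
  rwa [Polynomial.aeval_algebraMap_apply, ← map_zero (algebraMap L Ω)] at hα

/-! ### Adjoining a square root of -1 to a real closed field -/

/-- The algebra `R[i]` obtained from `R` by adjoining a square root of `-1`. -/
abbrev AdjoinI (R : Type*) [CommRing R] := QuadraticAlgebra R (-1) 0

namespace AdjoinI

instance fact_sq_ne {R : Type*} [Field R] [IsSemireal R] :
    Fact (∀ r : R, r ^ 2 ≠ -1 + 0 * r) :=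
  ⟨fun r hr => IsSemireal.not_isSumSq_neg_one R <| by
    rw [show (-1 : R) = r * r by linear_combination -hr]
    exact IsSumSq.mul_self r⟩

section RealClosed

variable {R : Type*} [Field R] [IsRealClosed R]

/-- A sum of two squares in a real closed field is a square. -/
theorem exists_sq_add_sq_eq_sq (a b : R) : ∃ c : R, a ^ 2 + b ^ 2 = c ^ 2 := by
  rcases IsRealClosed.isSquare_or_isSquare_neg (a ^ 2 + b ^ 2) with ⟨c, hc⟩ | ⟨c, hc⟩
  · exact ⟨c, by rw [hc, sq]⟩
  · by_cases ha : a = 0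
    · exact ⟨b, by simp [ha]⟩
    · exfalso
      apply IsSemireal.not_isSumSq_neg_one R
      rw [show (-1 : R) = (b / a) * (b / a) + (c / a) * (c / a) by
        field_simp; linear_combination hc]
      exact (IsSumSq.mul_self _).add (IsSumSq.mul_self _)

theorem isSquare (z : AdjoinI R) : IsSquare z := by
  obtain ⟨a, b⟩ := z
  by_cases hb : b = 0
  · subst hb
    rcases IsRealClosed.isSquare_or_isSquare_neg a with ⟨c, hc⟩ | ⟨c, hc⟩
    · exact ⟨⟨c, 0⟩, by ext <;> simp [hc]⟩
    · exact ⟨⟨0, c⟩, by ext <;> simp [← hc]⟩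
  -- Since (a + c)(a - c) = -b², one of (a ± c)/2 is a square; the sign of `c` is chosen
  -- accordingly. The root sought is then x + (b/2x)i.
  · have key : ∃ c x : R, a ^ 2 + b ^ 2 = c ^ 2 ∧ (a + c) / 2 = x ^ 2 := by
      obtain ⟨c, hc⟩ := exists_sq_add_sq_eq_sq a b
      rcases IsRealClosed.isSquare_or_isSquare_neg ((a + c) / 2) with ⟨x, hx⟩ | ⟨x, hx⟩
      · exact ⟨c, x, hc, by rw [hx, sq]⟩
      · have hx0 : x ≠ 0 := by
          rintro rfl
          apply hb
          have : a + c = 0 := by linear_combination -2 * hx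
          have : b ^ 2 = 0 := by linear_combination hc + (c - a) * this
          exact pow_eq_zero_iff two_ne_zero |>.1 this
        refine ⟨-c, b / (2 * x), by rw [hc]; ring, ?_⟩
        field_simp
        linear_combination (-2 * (a - c)) * hx - hc
    obtain ⟨c, x, hc, hx⟩ := key
    have hx0 : x ≠ 0 := by
      rintro rfl
      apply hb
      have : a + c = 0 := by linear_combination 2 * hx
      have : b ^ 2 = 0 := by linear_combination hc + (c - a) * this
      exact pow_eq_zero_iff two_ne_zero |>.1 this
    refine ⟨⟨x, b / (2 * x)⟩, ?_⟩
    ext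
    · simp only [QuadraticAlgebra.re_mul]
      field_simp
      linear_combination (4 * x ^ 2 + 2 * (c - a)) * hx + hc
    · simp only [QuadraticAlgebra.im_mul]
      field_simp
      ring

/-- If `R` is real closed, then `R[i]` is algebraically closed. -/
theorem isAlgClosed : IsAlgClosed (AdjoinI R) :=
  isAlgClosed_of_odd_root_of_isSquare (R := R)
    (fun _ hf => IsRealClosed.exists_isRoot_of_odd_natDegree hf) isSquare

end RealClosed

end AdjoinI

/-! ### Points over algebraically closed fields and tensor products of domains -/

/-- By Zariski's lemma a residue field of `A` is finite over `E`, so it embeds in `L`. -/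
theorem nonempty_algHom_of_isAlgClosed {E L A : Type*} [Field E] [Field L] [IsAlgClosed L]
    [Algebra E L] [CommRing A] [Nontrivial A] [Algebra E A] [Algebra.FiniteType E A] :
    Nonempty (A →ₐ[E] L) := by
  obtain ⟨m, hm⟩ := Ideal.exists_maximal A
  let _ := Ideal.Quotient.field m
  have := finite_of_finite_type_of_isJacobsonRing E (A ⧸ m)
  exact ⟨(IsAlgClosed.lift : (A ⧸ m) →ₐ[E] L).comp (Ideal.Quotient.mkₐ E m)⟩

/-- Rabinowitsch's trick: a point of the localization at `a` is a point of `A` where `a` does not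
vanish. -/
theorem exists_algHom_apply_ne_zero {E L A : Type*} [Field E] [Field L] [IsAlgClosed L]
    [Algebra E L] [CommRing A] [IsReduced A] [Algebra E A] [Algebra.FiniteType E A] {a : A}
    (ha : a ≠ 0) : ∃ φ : A →ₐ[E] L, φ a ≠ 0 := by
  have : Nontrivial (Localization.Away a) := by
    rw [← not_subsingleton_iff_nontrivial,
      IsLocalization.subsingleton_iff (M := Submonoid.powers a)]
    rintro ⟨n, hn⟩
    exact ha (IsReduced.eq_zero a ⟨n, hn⟩)
  have : Algebra.FiniteType A (Localization.Away a) :=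
    IsLocalization.finiteType_of_monoid_fg (Submonoid.powers a) _
  have : Algebra.FiniteType E (Localization.Away a) := Algebra.FiniteType.trans (S := A) ‹_› ‹_›
  obtain ⟨φ⟩ := nonempty_algHom_of_isAlgClosed (E := E) (L := L) (A := Localization.Away a)
  refine ⟨φ.comp (IsScalarTower.toAlgHom E A _), ?_⟩
  exact ((IsLocalization.Away.algebraMap_isUnit (S := Localization.Away a) a).map φ).ne_zero

/-- Over an algebraically closed field, the tensor product of two domains, one of which is of
finite type, is a domain. -/
theorem isDomain_tensorProduct_of_isAlgClosed {k A B : Type*} [Field k] [IsAlgClosed k]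
    [CommRing A] [IsDomain A] [Algebra k A] [Algebra.FiniteType k A] [CommRing B] [IsDomain B]
    [Algebra k B] : IsDomain (A ⊗[k] B) := by
  classical
  let b := Module.Basis.ofVectorSpace k B
  let c := TensorProduct.equivFinsuppOfBasisRight (M := A) b
  let ev (φ : A →ₐ[k] k) : A ⊗[k] B →ₐ[k] B :=
    Algebra.TensorProduct.lift ((Algebra.ofId k B).comp φ) (AlgHom.id k B) fun _ _ => .all _ _
  have hev (φ : A →ₐ[k] k) (x : A ⊗[k] B) (j) : b.repr (ev φ x) j = φ (c x j) := by
    induction x with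
    | zero => simp
    | add x y hx hy => simp [hx, hy]
    | tmul x y =>
      have : ev φ (x ⊗ₜ y) = φ x • y := by
        simp [ev, Algebra.ofId_apply, Algebra.smul_def]
      rw [this]
      simp [c, mul_comm]
  have : Nontrivial (A ⊗[k] B) := inferInstance
  have : NoZeroDivisors (A ⊗[k] B) := by
    refine ⟨fun {x y} hxy => ?_⟩
    by_contra! h
    have hx : c x ≠ 0 := by simpa using h.1
    have hy : c y ≠ 0 := by simpa using h.2
    obtain ⟨i, hi⟩ := Finsupp.ne_iff.1 hx
    obtain ⟨j, hj⟩ := Finsupp.ne_iff.1 hy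
    -- At a point of `A` where a coordinate of `x` and one of `y` are both nonzero, `x` and `y`
    -- specialize to nonzero elements of the domain `B` with product zero.
    obtain ⟨φ, hφ⟩ := exists_algHom_apply_ne_zero (E := k) (L := k) (mul_ne_zero hi hj)
    rw [map_mul] at hφ
    have h0 : ev φ x * ev φ y = 0 := by rw [← map_mul, hxy, map_zero]
    rcases mul_eq_zero.1 h0 with h0 | h0
    · exact left_ne_zero_of_mul hφ (by rw [← hev, h0]; simp)
    · exact right_ne_zero_of_mul hφ (by rw [← hev, h0]; simp)
  exact IsDomain.mk

/-! ### PAC and PRC in terms of algebras -/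

/-- The base change of a presentation is prime precisely when the base change of the presented
algebra is a domain. -/
theorem isPrime_map_ker_iff_isDomain {F K B σ : Type*} [CommRing F] [CommRing K] [Algebra F K]
    [CommRing B] [Algebra F B] (π : MvPolynomial σ F →ₐ[F] B) (hπ : Function.Surjective π) :
    ((RingHom.ker π).map (MvPolynomial.map (algebraMap F K))).IsPrime ↔ IsDomain (K ⊗[F] B) := by
  let e := MvPolynomial.algebraTensorAlgEquiv F K (σ := σ)
  let T := Algebra.TensorProduct.map (AlgHom.id F K) π
  have hT : Function.Surjective T := TensorProduct.map_surjective Function.surjective_id hπ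
  let g : MvPolynomial σ K →+* K ⊗[F] B := T.toRingHom.comp (e.symm : _ →+* _)
  have hg : Function.Surjective g := hT.comp e.symm.surjective
  have hker : RingHom.ker g = (RingHom.ker π).map (MvPolynomial.map (algebraMap F K)) := by
    have h1 : RingHom.ker g = (RingHom.ker T).comap (e.symm : MvPolynomial σ K →+* _) := rfl
    have h2 : (MvPolynomial.map (algebraMap F K)) =
        (e : K ⊗[F] MvPolynomial σ F →+* MvPolynomial σ K).comp
          (Algebra.TensorProduct.includeRight : MvPolynomial σ F →ₐ[F] _).toRingHom := by
      ext <;> simp [e]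
    rw [h1, Algebra.TensorProduct.lTensor_ker π hπ, h2, ← Ideal.map_map]
    exact (Ideal.comap_symm (e : K ⊗[F] MvPolynomial σ F ≃+* MvPolynomial σ K))
  rw [← hker, ← Ideal.Quotient.isDomain_iff_prime]
  exact (RingHom.quotientKerEquivOfSurjective hg).toMulEquiv.isDomain_iff

theorem IsAbsIrreducible.isDomain {F : Type*} [Field F] {n : ℕ}
    {I : Ideal (MvPolynomial (Fin n) F)} (hI : IsAbsIrreducible I) :
    IsDomain (AlgebraicClosure F ⊗[F] (MvPolynomial (Fin n) F ⧸ I)) := by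
  rw [← isPrime_map_ker_iff_isDomain (Ideal.Quotient.mkₐ F I) Ideal.Quotient.mk_surjective]
  have : RingHom.ker (Ideal.Quotient.mkₐ F I) = I := Ideal.Quotient.mkₐ_ker F I
  rwa [this]

/-- A field is pseudo-algebraically closed if every geometrically integral algebra of finite type
over it has a rational point. -/
theorem IsPAC.of_exists_algHom {F : Type u} [Field F]
    (h : ∀ (A : Type u) [CommRing A] [Algebra F A] [Algebra.FiniteType F A]
      [IsDomain (AlgebraicClosure F ⊗[F] A)], Nonempty (A →ₐ[F] F)) : IsPAC F := by
  intro n I hI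
  have := hI.isDomain
  obtain ⟨φ⟩ := h (MvPolynomial (Fin n) F ⧸ I)
  refine ⟨fun j => φ (Ideal.Quotient.mk I (MvPolynomial.X j)), fun p hp => ?_⟩
  have : MvPolynomial.aeval (fun j => φ (Ideal.Quotient.mk I (MvPolynomial.X j))) =
      φ.comp (Ideal.Quotient.mkₐ F I) := by
    ext; simp
  rw [this, AlgHom.comp_apply, Ideal.Quotient.mkₐ_eq_mk, Ideal.Quotient.eq_zero_iff_mem.2 hp,
    map_zero]

/-- A smooth geometrically integral algebra over a pseudo real closed field with a point over every
real closed extension has a rational point. -/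
theorem IsPRC.exists_algHom {F : Type u} [Field F] (hF : IsPRC F) (B : Type u) [CommRing B]
    [Algebra F B] [Algebra.FiniteType F B] [Algebra.FormallySmooth F B]
    [IsDomain (AlgebraicClosure F ⊗[F] B)]
    (hK : ∀ (K : Type u) [Field K] [Algebra F K] [IsRealClosed K], Nonempty (B →ₐ[F] K)) :
    Nonempty (B →ₐ[F] F) := by
  obtain ⟨n, π, hπ⟩ := Algebra.FiniteType.iff_quotient_mvPolynomial''.1 ‹Algebra.FiniteType F B›
  let e : (MvPolynomial (Fin n) F ⧸ RingHom.ker π) ≃ₐ[F] B :=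
    Ideal.quotientKerAlgEquivOfSurjective hπ
  have : Algebra.FormallySmooth F (MvPolynomial (Fin n) F ⧸ RingHom.ker π) :=
    .of_equiv e.symm
  obtain ⟨x, hx⟩ := hF n (RingHom.ker π) ((isPrime_map_ker_iff_isDomain π hπ).2 ‹_›) fun K _ _ _ => by
    obtain ⟨φ⟩ := hK K
    have haev : MvPolynomial.aeval (fun j => φ (π (MvPolynomial.X j))) = φ.comp π := by
      ext; simp
    refine ⟨fun j => φ (π (MvPolynomial.X j)), fun p hp => ?_, ?_⟩
    · rw [haev, AlgHom.comp_apply, (RingHom.mem_ker).1 hp, map_zero]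
    -- Every localization of a formally smooth algebra is formally smooth, so every point is simple.
    · exact inferInstanceAs (Algebra.FormallySmooth F (Localization _))
  exact ⟨(Ideal.Quotient.liftₐ (RingHom.ker π) (MvPolynomial.aeval x) fun p hp => hx p hp).comp e.symm.toAlgHom⟩

/-- Carries the result from `AdjoinI F` to `F⟮i⟯`. Extending the isomorphism to the algebraic
closures preserves absolute irreducibility. -/
theorem IsPAC.of_ringEquiv {E : Type u} {E' : Type v} [Field E] [Field E'] (e : E ≃+* E')
    (hE : IsPAC E) : IsPAC E' := by
  intro n I' hI'
  let τ : AlgebraicClosure E' ≃+* AlgebraicClosure E :=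
    IsAlgClosure.equivOfEquiv (AlgebraicClosure E') (AlgebraicClosure E) e.symm
  have hτ : (algebraMap E (AlgebraicClosure E)).comp (e.symm : E' →+* E) =
      (τ : _ →+* _).comp (algebraMap E' (AlgebraicClosure E')) := by
    ext x
    exact (IsAlgClosure.equivOfEquiv_algebraMap _ _ e.symm x).symm
  have hI : IsAbsIrreducible (I'.map (MvPolynomial.map (e.symm : E' →+* E))) := by
    have : Ideal.IsPrime (I'.map (MvPolynomial.map (algebraMap E' (AlgebraicClosure E')))) := hI'
    have hcomp : (MvPolynomial.map (algebraMap E (AlgebraicClosure E)) :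
        MvPolynomial (Fin n) E →+* _).comp (MvPolynomial.map (e.symm : E' →+* E)) =
        ((MvPolynomial.mapEquiv (Fin n) τ : _ ≃+* _) : _ →+* _).comp
          (MvPolynomial.map (algebraMap E' (AlgebraicClosure E'))) := by
      apply RingHom.ext
      intro p
      simp only [RingHom.comp_apply, MvPolynomial.map_map, hτ]
      exact (MvPolynomial.map_map _ _ p).symm
    rw [IsAbsIrreducible, Ideal.map_map, hcomp, ← Ideal.map_map]
    exact Ideal.map_isPrime_of_equiv _
  obtain ⟨x, hx⟩ := hE n _ hI
  refine ⟨fun j => e (x j), fun p hp => ?_⟩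
  have h0 := congrArg e (hx _ (Ideal.mem_map_of_mem _ hp))
  rw [map_zero, MvPolynomial.aeval_def, MvPolynomial.eval₂_map, Algebra.algebraMap_self,
    RingHom.id_comp] at h0
  rw [MvPolynomial.aeval_def, Algebra.algebraMap_self, ← h0]
  have := MvPolynomial.eval₂_comp_left (e : E →+* E') (e.symm : E' →+* E) x p
  rw [RingEquiv.comp_symm] at this
  exact this.symm

/-! ### Generic smoothness -/

/-- A domain of finite type over a perfect field is generically smooth. -/
theorem exists_formallySmooth_localizationAway (E A : Type*) [Field E] [PerfectField E] [CommRing A]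
    [IsDomain A] [Algebra E A] [Algebra.FiniteType E A] :
    ∃ f : A, f ≠ 0 ∧ Algebra.FormallySmooth E (Localization.Away f) := by
  have : Algebra.FinitePresentation E A := Algebra.FinitePresentation.of_finiteType.1 ‹_›
  let η : PrimeSpectrum A := ⟨⊥, Ideal.isPrime_bot⟩
  have : η.asIdeal.IsPrime := η.2
  have hprime : η.asIdeal.primeCompl = nonZeroDivisors A := by
    ext x
    simp [η, Ideal.mem_primeCompl_iff]
  -- The local ring at the generic point is the fraction field, which is formally smooth because `E`
  -- is perfect. Openness of the smooth locus then supplies `f`.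
  have hη : η ∈ Algebra.smoothLocus E A := by
    change Algebra.FormallySmooth E (Localization.AtPrime η.asIdeal)
    have hfrac : ∀ (S : Type _) [CommRing S] [Algebra A S] (M : Submonoid A)
        [IsLocalization M S], M = nonZeroDivisors A → IsFractionRing A S := by
      rintro S _ _ M hM rfl
      exact hM
    have := hfrac (Localization.AtPrime η.asIdeal) _ hprime
    let e : FractionRing A ≃ₐ[A] Localization.AtPrime η.asIdeal :=
      FractionRing.algEquiv A (Localization.AtPrime η.asIdeal)
    have : IsLocalization (nonZeroDivisors A) (FractionRing A) := Localization.isLocalization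
    have : Algebra.EssFiniteType A (FractionRing A) := .of_isLocalization _ (nonZeroDivisors A)
    have : Algebra.EssFiniteType E (FractionRing A) := .comp _ A _
    exact .of_equiv (e.restrictScalars E)
  obtain ⟨_, ⟨_, ⟨f, rfl⟩, rfl⟩, hηf, hf⟩ :=
    PrimeSpectrum.isBasis_basic_opens.exists_subset_of_mem_open hη Algebra.isOpen_smoothLocus
  exact ⟨f, hηf, Algebra.basicOpen_subset_smoothLocus_iff.1 hf⟩

theorem isDomain_tensorProduct_localizationAway {E K A : Type*} [Field E] [Field K] [Algebra E K]
    [CommRing A] [Algebra E A] [IsDomain (K ⊗[E] A)] {f : A} (hf : f ≠ 0) :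
    IsDomain (K ⊗[E] Localization.Away f) := by
  have h0 : (1 : K) ⊗ₜ[E] f ≠ 0 := fun h => hf <|
    Algebra.TensorProduct.includeRight_injective (A := K) (B := A) (algebraMap E K).injective
      (by simpa using h)
  have : IsDomain (Localization.Away ((1 : K) ⊗ₜ[E] f)) :=
    IsLocalization.isDomain_localization (powers_le_nonZeroDivisors_of_noZeroDivisors h0)
  exact (IsLocalization.Away.tensorProductEquivTMulRight E K f
    (Localization.Away f)).toMulEquiv.isDomain

/-- Over a perfect field, it suffices to find rational points on smooth varieties. -/
theorem IsPAC.of_exists_algHom_of_formallySmooth {F : Type u} [Field F] [PerfectField F]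
    (h : ∀ (A : Type u) [CommRing A] [Algebra F A] [Algebra.FiniteType F A]
      [Algebra.FormallySmooth F A] [IsDomain (AlgebraicClosure F ⊗[F] A)],
      Nonempty (A →ₐ[F] F)) : IsPAC F := by
  refine IsPAC.of_exists_algHom fun A _ _ _ _ => ?_
  have : IsDomain A := (Algebra.TensorProduct.includeRight_injective (A := AlgebraicClosure F)
    (B := A) (algebraMap F (AlgebraicClosure F)).injective).isDomain
      (Algebra.TensorProduct.includeRight : A →ₐ[F] AlgebraicClosure F ⊗[F] A).toRingHom
  obtain ⟨f, hf, _⟩ := exists_formallySmooth_localizationAway F A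
  have := isDomain_tensorProduct_localizationAway (K := AlgebraicClosure F) (E := F) hf
  have : Algebra.FiniteType F (Localization.Away f) :=
    .trans ‹_› (IsLocalization.finiteType_of_monoid_fg (Submonoid.powers f) _)
  obtain ⟨φ⟩ := h (Localization.Away f)
  exact ⟨φ.comp (IsScalarTower.toAlgHom F A _)⟩

/-! ### Maps to and from `R[i]`, and Weil restriction -/

namespace AdjoinI

section Map

variable {R S T : Type*} [CommRing R] [CommRing S] [CommRing T]

/-- The ring homomorphism `R[i] → S[i]` induced by `R → S`. -/
@[simps]
def map (f : R →+* S) : AdjoinI R →+* AdjoinI S where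
  toFun z := ⟨f z.re, f z.im⟩
  map_zero' := by ext <;> simp
  map_one' := by ext <;> simp [QuadraticAlgebra.re_one, QuadraticAlgebra.im_one]
  map_add' x y := by ext <;> simp
  map_mul' x y := by ext <;> simp

theorem map_map (g : S →+* T) (f : R →+* S) (z : AdjoinI R) :
    map g (map f z) = map (g.comp f) z := rfl

theorem map_comp (g : S →+* T) (f : R →+* S) : map (g.comp f) = (map g).comp (map f) := rfl

/-- The ring homomorphism `R[i] → S` which extends `R → S` and sends `i` to `j`. -/
@[simps]
def eval (f : R →+* S) (j : S) (hj : j * j = -1) : AdjoinI R →+* S where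
  toFun z := f z.re + f z.im * j
  map_zero' := by simp
  map_one' := by simp [QuadraticAlgebra.re_one, QuadraticAlgebra.im_one]
  map_add' x y := by simp; ring
  map_mul' x y := by simp; linear_combination (-f x.im * f y.im) * hj

theorem comp_eval (g : S →+* T) (f : R →+* S) (j : S) (hj : j * j = -1) :
    g.comp (eval f j hj) = eval (g.comp f) (g j) (by rw [← map_mul, hj, map_neg, map_one]) := by
  ext z; simp

theorem eval_comp_map (g : S →+* T) (f : R →+* S) (j : T) (hj : j * j = -1) :
    (eval g j hj).comp (map f) = eval (g.comp f) j hj := rfl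

variable {A : Type*} [CommRing A]

/-- If `S` contains `1 / 2` and a square root of `-1`, then `S[i]` is `S × S`. -/
@[simps]
def pair (h j : S) (hh : 2 * h = 1) (hj : j * j = -1) (f g : A →+* S) : A →+* AdjoinI S where
  toFun a := ⟨h * (f a + g a), -h * j * (f a - g a)⟩
  map_zero' := by ext <;> simp
  map_one' := by
    ext
    · simp [QuadraticAlgebra.re_one]; linear_combination hh
    · simp [QuadraticAlgebra.im_one]
  map_add' x y := by ext <;> simp <;> ring
  map_mul' x y := by
    ext
    · simp
      linear_combination (- h * (f x * f y + g x * g y)) * hh +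
        (h * h * (f x - g x) * (f y - g y)) * hj
    · simp
      linear_combination (h * j * (f x * f y - g x * g y)) * hh

theorem eval_pair {h j : S} (hh : 2 * h = 1) (hj : j * j = -1) (f g : A →+* S) :
    (eval (RingHom.id S) j hj).comp (pair h j hh hj f g) = f := by
  ext a
  simp
  linear_combination f a * hh - h * (f a - g a) * hj

theorem eval_neg_pair {h j : S} (hh : 2 * h = 1) (hj : j * j = -1) (f g : A →+* S) :
    (eval (RingHom.id S) (-j) (by simpa using hj)).comp (pair h j hh hj f g) = g := by
  ext a
  simp
  linear_combination g a * hh + h * (f a - g a) * hj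

/-- The element a + bi is recovered from its two evaluations a + bj and a - bj, using 1/2 and `j`.
-/
theorem hom_ext_eval {h j : S} (hh : 2 * h = 1) (hj : j * j = -1) {f g : A →+* AdjoinI S}
    (h1 : (eval (RingHom.id S) j hj).comp f = (eval (RingHom.id S) j hj).comp g)
    (h2 : (eval (RingHom.id S) (-j) (by simpa using hj)).comp f =
      (eval (RingHom.id S) (-j) (by simpa using hj)).comp g) : f = g := by
  ext a
  · have e1 := RingHom.congr_fun h1 a
    have e2 := RingHom.congr_fun h2 a
    simp at e1 e2
    linear_combination h * e1 + h * e2 - ((f a).re - (g a).re) * hh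
  · have e1 := RingHom.congr_fun h1 a
    have e2 := RingHom.congr_fun h2 a
    simp at e1 e2
    linear_combination -h * j * e1 + h * j * e2 - ((f a).im - (g a).im) * hh +
      2 * h * ((f a).im - (g a).im) * hj

end Map

/-- `B`, with the universal homomorphism `Φ : A → B[i]`, is the Weil restriction of the
`F[i]`-algebra `A` to `F`. -/
structure IsWeilRestriction (F : Type u) {A B : Type u} [CommRing F] [CommRing A] [CommRing B]
    [Algebra (AdjoinI F) A] [Algebra F B] (Φ : A →+* AdjoinI B) : Prop where
  comp_algebraMap : Φ.comp (algebraMap (AdjoinI F) A) = map (algebraMap F B)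
  exists_lift : ∀ {C : Type u} [CommRing C] [Algebra F C] (ψ : A →+* AdjoinI C),
    ψ.comp (algebraMap (AdjoinI F) A) = map (algebraMap F C) →
      ∃ φ : B →ₐ[F] C, (map (φ : B →+* C)).comp Φ = ψ
  hom_ext : ∀ {C : Type u} [CommRing C] [Algebra F C] (φ₁ φ₂ : B →ₐ[F] C),
    (map (φ₁ : B →+* C)).comp Φ = (map (φ₂ : B →+* C)).comp Φ → φ₁ = φ₂

/-- Weil restrictions exist. -/
theorem exists_isWeilRestriction (F A : Type u) [CommRing F] [CommRing A]
    [Algebra (AdjoinI F) A] [Algebra.FiniteType (AdjoinI F) A] :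
    ∃ (B : Type u) (_ : CommRing B) (_ : Algebra F B) (Φ : A →+* AdjoinI B),
      Algebra.FiniteType F B ∧ IsWeilRestriction F Φ := by
  obtain ⟨n, π, hπ⟩ := Algebra.FiniteType.iff_quotient_mvPolynomial''.1
    ‹Algebra.FiniteType (AdjoinI F) A›
  let P := MvPolynomial (Fin n ⊕ Fin n) F
  let θ : MvPolynomial (Fin n) (AdjoinI F) →+* AdjoinI P :=
    MvPolynomial.eval₂Hom (map MvPolynomial.C)
      fun k => ⟨MvPolynomial.X (.inl k), MvPolynomial.X (.inr k)⟩
  have hθC (z) : θ (MvPolynomial.C z) = map MvPolynomial.C z := MvPolynomial.eval₂Hom_C _ _ _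
  have hθX (k) : θ (MvPolynomial.X k) = ⟨MvPolynomial.X (.inl k), MvPolynomial.X (.inr k)⟩ :=
    MvPolynomial.eval₂Hom_X' _ _ _
  -- Each variable is replaced by a real part plus `i` times an imaginary part; both parts of every
  -- relation of `A` must vanish.
  let J : Ideal P := Ideal.span
    ((fun p => (θ p).re) '' RingHom.ker π ∪ (fun p => (θ p).im) '' RingHom.ker π)
  let Φ₀ : MvPolynomial (Fin n) (AdjoinI F) →+* AdjoinI (P ⧸ J) :=
    (map (Ideal.Quotient.mk J)).comp θ
  have hΦ₀ : RingHom.ker (π : MvPolynomial (Fin n) (AdjoinI F) →+* A) ≤ RingHom.ker Φ₀ := by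
    intro p hp
    rw [RingHom.mem_ker]
    ext
    · exact Ideal.Quotient.eq_zero_iff_mem.2 (Ideal.subset_span (.inl ⟨p, hp, rfl⟩))
    · exact Ideal.Quotient.eq_zero_iff_mem.2 (Ideal.subset_span (.inr ⟨p, hp, rfl⟩))
  let Φ : A →+* AdjoinI (P ⧸ J) :=
    RingHom.liftOfSurjective (π : MvPolynomial (Fin n) (AdjoinI F) →+* A) hπ ⟨Φ₀, hΦ₀⟩
  have hΦ (p) : Φ (π p) = Φ₀ p := RingHom.liftOfRightInverse_comp_apply _ _ _ ⟨Φ₀, hΦ₀⟩ p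
  have hΦX (k) : Φ (π (MvPolynomial.X k)) = ⟨Ideal.Quotient.mk J (MvPolynomial.X (.inl k)),
      Ideal.Quotient.mk J (MvPolynomial.X (.inr k))⟩ := by
    rw [hΦ]
    simp only [Φ₀, RingHom.comp_apply, hθX]
    rfl
  refine ⟨P ⧸ J, inferInstance, inferInstance, Φ, inferInstance, ?_, ?_, ?_⟩
  · ext1 z
    rw [RingHom.comp_apply, ← π.commutes, hΦ, MvPolynomial.algebraMap_eq, RingHom.comp_apply, hθC]
    rfl
  · intro C _ _ ψ hψ
    let φ₀ : P →ₐ[F] C := MvPolynomial.aeval (Sum.elim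
      (fun k => (ψ (π (MvPolynomial.X k))).re) (fun k => (ψ (π (MvPolynomial.X k))).im))
    have hφ₀ : (map (φ₀ : P →+* C)).comp θ = ψ.comp (π : _ →+* A) := by
      refine MvPolynomial.ringHom_ext (fun z => ?_) fun k => ?_
      · have hz : ψ (π (MvPolynomial.C z)) = map (algebraMap F C) z := by
          rw [← MvPolynomial.algebraMap_eq, π.commutes]
          exact RingHom.congr_fun hψ z
        rw [RingHom.comp_apply, RingHom.comp_apply, hθC, RingHom.coe_coe, hz]
        ext
        · exact φ₀.commutes z.re
        · exact φ₀.commutes z.im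
      · rw [RingHom.comp_apply, RingHom.comp_apply, hθX]
        ext
        · exact MvPolynomial.aeval_X _ _
        · exact MvPolynomial.aeval_X _ _
    have hJ : ∀ p ∈ J, φ₀ p = 0 := by
      intro p hp
      have hle : J ≤ RingHom.ker φ₀ := by
        refine Ideal.span_le.2 (Set.union_subset ?_ ?_)
        · rintro _ ⟨q, hq, rfl⟩
          have := congrArg QuadraticAlgebra.re (RingHom.congr_fun hφ₀ q)
          simpa [(RingHom.mem_ker).1 hq] using this
        · rintro _ ⟨q, hq, rfl⟩
          have := congrArg QuadraticAlgebra.im (RingHom.congr_fun hφ₀ q)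
          simpa [(RingHom.mem_ker).1 hq] using this
      exact hle hp
    refine ⟨Ideal.Quotient.liftₐ J φ₀ hJ, ?_⟩
    ext1 a
    obtain ⟨p, rfl⟩ := hπ a
    have := RingHom.congr_fun hφ₀ p
    rw [RingHom.comp_apply, hΦ]
    exact this
  · intro C _ _ φ₁ φ₂ h
    apply Ideal.Quotient.algHom_ext
    refine MvPolynomial.algHom_ext ?_
    rintro (k | k)
    · have := congrArg QuadraticAlgebra.re (RingHom.congr_fun h (π (MvPolynomial.X k)))
      simpa [hΦX] using this
    · have := congrArg QuadraticAlgebra.im (RingHom.congr_fun h (π (MvPolynomial.X k)))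
      simpa [hΦX] using this

end AdjoinI

/-! ### Smoothness and geometric integrality of the Weil restriction -/

namespace AdjoinI

/-- The Weil restriction of a formally smooth algebra is formally smooth. -/
theorem IsWeilRestriction.formallySmooth {F A B : Type u} [CommRing F] [CommRing A] [CommRing B]
    [Algebra (AdjoinI F) A] [Algebra F B] {Φ : A →+* AdjoinI B} (hΦ : IsWeilRestriction F Φ)
    [Algebra.FormallySmooth (AdjoinI F) A] : Algebra.FormallySmooth F B := by
  refine Algebra.FormallySmooth.of_comp_surjective fun C _ _ I hI g => ?_
  -- Lifting `B → C ⧸ I` to `C` amounts to lifting `A → (C ⧸ I)[i]` to `C[i]`, again along a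
  -- surjection with square-zero kernel.
  let _ : Algebra (AdjoinI F) (AdjoinI C) := (map (algebraMap F C)).toAlgebra
  let _ : Algebra (AdjoinI F) (AdjoinI (C ⧸ I)) := (map (algebraMap F (C ⧸ I))).toAlgebra
  let q : AdjoinI C →ₐ[AdjoinI F] AdjoinI (C ⧸ I) :=
    { map (Ideal.Quotient.mk I) with commutes' := fun _ => rfl }
  let ψ : A →ₐ[AdjoinI F] AdjoinI (C ⧸ I) :=
    { (map (g : B →+* C ⧸ I)).comp Φ with
      commutes' := fun z => by
        have h1 := RingHom.congr_fun hΦ.comp_algebraMap z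
        have h2 : map (g : B →+* C ⧸ I) (Φ (algebraMap (AdjoinI F) A z)) =
            map (algebraMap F (C ⧸ I)) z := by
          rw [RingHom.comp_apply] at h1
          rw [h1, map_map, g.comp_algebraMap]
        exact h2 }
  have hq : Function.Surjective q := by
    rintro ⟨x, y⟩
    obtain ⟨x, rfl⟩ := Ideal.Quotient.mk_surjective x
    obtain ⟨y, rfl⟩ := Ideal.Quotient.mk_surjective y
    exact ⟨⟨x, y⟩, rfl⟩
  have hmul {x y : C} (hx : x ∈ I) (hy : y ∈ I) : x * y = 0 := by
    have := Ideal.mul_mem_mul hx hy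
    rwa [← sq, hI] at this
  have hnil : IsNilpotent (RingHom.ker (q : AdjoinI C →+* AdjoinI (C ⧸ I))) := by
    have hmem {z} (hz : z ∈ RingHom.ker (q : AdjoinI C →+* AdjoinI (C ⧸ I))) :
        z.re ∈ I ∧ z.im ∈ I := by
      have : map (Ideal.Quotient.mk I) z = 0 := hz
      exact ⟨Ideal.Quotient.eq_zero_iff_mem.1 (congrArg QuadraticAlgebra.re this),
        Ideal.Quotient.eq_zero_iff_mem.1 (congrArg QuadraticAlgebra.im this)⟩
    refine ⟨2, ?_⟩
    rw [sq, Ideal.zero_eq_bot, eq_bot_iff]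
    refine Ideal.mul_le.2 fun x hx y hy => ?_
    rw [Ideal.mem_bot]
    ext <;> simp [hmul (hmem hx).1 (hmem hy).1, hmul (hmem hx).1 (hmem hy).2,
      hmul (hmem hx).2 (hmem hy).1, hmul (hmem hx).2 (hmem hy).2]
  let ψ' : A →ₐ[AdjoinI F] AdjoinI C := Algebra.FormallySmooth.liftOfSurjective ψ q hq hnil
  have hψ' : q.comp ψ' = ψ := Algebra.FormallySmooth.comp_liftOfSurjective ψ q hq hnil
  obtain ⟨φ, hφ⟩ := hΦ.exists_lift (ψ' : A →+* AdjoinI C) ψ'.comp_algebraMap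
  refine ⟨φ, hΦ.hom_ext _ _ ?_⟩
  change (map (Ideal.Quotient.mk I)).comp ((map (φ : B →+* C)).comp Φ) = _
  rw [hφ]
  exact congrArg (fun f : A →ₐ[AdjoinI F] AdjoinI (C ⧸ I) => f.toRingHom) hψ'

end AdjoinI

/-- The base change of a geometrically integral algebra along an algebraic extension `ι : E → Ω`
with `Ω` algebraically closed is a domain. -/
theorem exists_isDomain_baseChange {E Ω : Type u} (A : Type u) [Field E] [Field Ω] [IsAlgClosed Ω]
    [CommRing A] [Algebra E A] [Algebra.FiniteType E A] [IsDomain (AlgebraicClosure E ⊗[E] A)]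
    (ι : E →+* Ω) (hι : ι.IsIntegral) :
    ∃ (R : Type u) (_ : CommRing R) (_ : Algebra Ω R) (a : A →+* R),
      IsDomain R ∧ Algebra.FiniteType Ω R ∧
      a.comp (algebraMap E A) = (algebraMap Ω R).comp ι ∧
      ∀ (S : Type u) [CommRing S] [Algebra Ω S] (g : A →+* S),
        g.comp (algebraMap E A) = (algebraMap Ω S).comp ι →
          ∃ h : R →ₐ[Ω] S, (h : R →+* S).comp a = g := by
  -- This structure stays inside the proof: describing `R` by its universal property lets two
  -- embeddings of `E` in the same `Ω` be used together.
  let _ : Algebra E Ω := ι.toAlgebra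
  have : Algebra.IsIntegral E Ω := ⟨hι⟩
  have : IsAlgClosure E Ω := ⟨‹_›, inferInstance⟩
  let e : AlgebraicClosure E ≃ₐ[E] Ω := IsAlgClosure.equiv E _ _
  refine ⟨Ω ⊗[E] A, inferInstance, inferInstance,
    (Algebra.TensorProduct.includeRight : A →ₐ[E] Ω ⊗[E] A), ?_, inferInstance, ?_, ?_⟩
  · exact (Algebra.TensorProduct.congr e.symm (AlgEquiv.refl : A ≃ₐ[E] A)).toMulEquiv.isDomain
  · rw [AlgHom.comp_algebraMap, IsScalarTower.algebraMap_eq E Ω]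
    rfl
  · intro S _ _ g hg
    let _ : Algebra E S := ((algebraMap Ω S).comp ι).toAlgebra
    have : IsScalarTower E Ω S := .of_algebraMap_eq' rfl
    let g' : A →ₐ[E] S := { g with commutes' := RingHom.congr_fun hg }
    refine ⟨Algebra.TensorProduct.lift (Algebra.ofId Ω S) g' fun _ _ => .all _ _, ?_⟩
    ext a
    simp [g']

/-- The tensor product over `Ω` of two base changes of a geometrically integral algebra is a
domain. -/
theorem exists_isDomain_baseChange₂ {E Ω : Type u} (A : Type u) [Field E] [Field Ω] [IsAlgClosed Ω]
    [CommRing A] [Algebra E A] [Algebra.FiniteType E A] [IsDomain (AlgebraicClosure E ⊗[E] A)]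
    (ι₁ ι₂ : E →+* Ω) (hι₁ : ι₁.IsIntegral) (hι₂ : ι₂.IsIntegral) :
    ∃ (R : Type u) (_ : CommRing R) (_ : Algebra Ω R) (a₁ a₂ : A →+* R),
      IsDomain R ∧
      a₁.comp (algebraMap E A) = (algebraMap Ω R).comp ι₁ ∧
      a₂.comp (algebraMap E A) = (algebraMap Ω R).comp ι₂ ∧
      ∀ (S : Type u) [CommRing S] [Algebra Ω S] (g₁ g₂ : A →+* S),
        g₁.comp (algebraMap E A) = (algebraMap Ω S).comp ι₁ →
        g₂.comp (algebraMap E A) = (algebraMap Ω S).comp ι₂ →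
          ∃ h : R →ₐ[Ω] S, (h : R →+* S).comp a₁ = g₁ ∧ (h : R →+* S).comp a₂ = g₂ := by
  obtain ⟨R₁, _, _, a₁, _, _, ha₁, hR₁⟩ := exists_isDomain_baseChange A ι₁ hι₁
  obtain ⟨R₂, _, _, a₂, _, _, ha₂, hR₂⟩ := exists_isDomain_baseChange A ι₂ hι₂
  refine ⟨R₁ ⊗[Ω] R₂, inferInstance, inferInstance,
    (Algebra.TensorProduct.includeLeft : R₁ →ₐ[Ω] R₁ ⊗[Ω] R₂).toRingHom.comp a₁,
    (Algebra.TensorProduct.includeRight : R₂ →ₐ[Ω] R₁ ⊗[Ω] R₂).toRingHom.comp a₂,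
    isDomain_tensorProduct_of_isAlgClosed, ?_, ?_, ?_⟩
  · rw [RingHom.comp_assoc, ha₁, ← RingHom.comp_assoc]
    congr 1
  · rw [RingHom.comp_assoc, ha₂, ← RingHom.comp_assoc]
    congr 1
    exact (Algebra.TensorProduct.includeRight : R₂ →ₐ[Ω] R₁ ⊗[Ω] R₂).comp_algebraMap
  · intro S _ _ g₁ g₂ hg₁ hg₂
    obtain ⟨h₁, hh₁⟩ := hR₁ S g₁ hg₁
    obtain ⟨h₂, hh₂⟩ := hR₂ S g₂ hg₂
    refine ⟨Algebra.TensorProduct.lift h₁ h₂ fun _ _ => .all _ _, ?_, ?_⟩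
    · ext a
      simpa using RingHom.congr_fun hh₁ a
    · ext a
      simpa using RingHom.congr_fun hh₂ a

namespace AdjoinI

/-- The Weil restriction of a geometrically integral algebra is geometrically integral. -/
theorem IsWeilRestriction.isDomain {F A B : Type u} [Field F] [IsSemireal F] [CommRing A]
    [CommRing B] [Algebra (AdjoinI F) A] [Algebra F B] {Φ : A →+* AdjoinI B}
    (hΦ : IsWeilRestriction F Φ) [Algebra.FiniteType (AdjoinI F) A]
    [IsDomain (AlgebraicClosure (AdjoinI F) ⊗[AdjoinI F] A)] :
    IsDomain (AlgebraicClosure F ⊗[F] B) := by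
  let Ω := AlgebraicClosure F
  have : CharZero Ω := charZero_of_injective_algebraMap (algebraMap F Ω).injective
  obtain ⟨j, hj⟩ := IsAlgClosed.exists_pow_nat_eq (-1 : Ω) two_pos
  rw [sq] at hj
  have hj' : -j * -j = -1 := by rw [neg_mul_neg, hj]
  have hint (k : Ω) (hk : k * k = -1) : (eval (algebraMap F Ω) k hk).IsIntegral := by
    refine RingHom.IsIntegral.tower_top (algebraMap F (AdjoinI F)) _ ?_
    have : (eval (algebraMap F Ω) k hk).comp (algebraMap F (AdjoinI F)) = algebraMap F Ω := by
      ext x; simp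
    rw [this]
    exact algebraMap_isIntegral_iff.2 inferInstance
  -- The two embeddings of `F(i)` in `Ω` send `i` to `j` and `-j`, so `R` is the tensor product of
  -- the two conjugate base changes of `A`.
  obtain ⟨R, _, _, a₁, a₂, _, ha₁, ha₂, hR⟩ :=
    exists_isDomain_baseChange₂ A _ _ (hint j hj) (hint (-j) hj')
  let _ : Algebra F R := ((algebraMap Ω R).comp (algebraMap F Ω)).toAlgebra
  have : IsScalarTower F Ω R := .of_algebraMap_eq' rfl
  have half (S : Type u) [CommRing S] [Algebra Ω S] : 2 * algebraMap Ω S (1 / 2) = 1 := by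
    rw [← map_ofNat (algebraMap Ω S) 2, ← map_mul, mul_one_div_cancel two_ne_zero, map_one]
  have hjS (S : Type u) [CommRing S] [Algebra Ω S] :
      algebraMap Ω S j * algebraMap Ω S j = -1 := by rw [← map_mul, hj, map_neg, map_one]
  have eval_tower (S : Type u) [CommRing S] [Algebra F S] [Algebra Ω S] [IsScalarTower F Ω S]
      (k : Ω) (hk : k * k = -1) (hk' : algebraMap Ω S k * algebraMap Ω S k = -1) :
      (algebraMap Ω S).comp (eval (algebraMap F Ω) k hk) =
        eval (algebraMap F S) (algebraMap Ω S k) hk' := by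
    rw [comp_eval, IsScalarTower.algebraMap_eq F Ω S]
  let ψ : A →+* AdjoinI R := pair _ _ (half R) (hjS R) a₁ a₂
  have hψ : ψ.comp (algebraMap (AdjoinI F) A) = map (algebraMap F R) := by
    refine hom_ext_eval (half R) (hjS R) ?_ ?_
    · rw [← RingHom.comp_assoc, eval_pair, ha₁, eval_tower R j hj (hjS R)]
      rfl
    · rw [← RingHom.comp_assoc, eval_neg_pair, ha₂,
        eval_tower R (-j) hj' (by simpa using hjS R)]
      ext z
      simp
  obtain ⟨θ, hθ⟩ := hΦ.exists_lift ψ hψ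
  let θ' : Ω ⊗[F] B →ₐ[Ω] R := Algebra.TensorProduct.lift (Algebra.ofId Ω R) θ fun _ _ => .all _ _
  let S := Ω ⊗[F] B
  let inc : B →ₐ[F] S := Algebra.TensorProduct.includeRight
  have hΦinc (k : S) (hk : k * k = -1) :
      ((eval (inc : B →+* S) k hk).comp Φ).comp (algebraMap (AdjoinI F) A) =
        eval (algebraMap F S) k hk := by
    rw [RingHom.comp_assoc, hΦ.comp_algebraMap, eval_comp_map]
    congr 1
    exact inc.comp_algebraMap
  have hjS' : algebraMap Ω S (-j) * algebraMap Ω S (-j) = -1 := by rw [map_neg, neg_mul_neg, hjS S]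
  obtain ⟨s, hs₁, hs₂⟩ := hR S ((eval (inc : B →+* S) _ (hjS S)).comp Φ)
    ((eval (inc : B →+* S) _ hjS').comp Φ)
    (by rw [hΦinc, eval_tower S j hj (hjS S)]) (by rw [hΦinc, eval_tower S (-j) hj' hjS'])
  -- A left inverse `s` of `θ'` suffices: it embeds `Ω ⊗[F] B` in the domain `R`. Equality is tested
  -- on the universal map, then after each of the two evaluations.
  have hsθ : (s.restrictScalars F).comp θ = inc := by
    refine hΦ.hom_ext _ _ ?_
    have h1 : (map (((s.restrictScalars F).comp θ : B →ₐ[F] S) : B →+* S)).comp Φ =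
        (map (s : R →+* S)).comp ψ := by
      rw [← hθ]
      rfl
    rw [h1]
    refine hom_ext_eval (half S) (hjS S) ?_ ?_
    · have h2 : (eval (RingHom.id S) _ (hjS S)).comp (map (s : R →+* S)) =
          (s : R →+* S).comp (eval (RingHom.id R) _ (hjS R)) := by
        ext z; simp
      rw [← RingHom.comp_assoc, h2, RingHom.comp_assoc, eval_pair, hs₁]
      rfl
    · have h2 : (eval (RingHom.id S) (-algebraMap Ω S j) (by rw [neg_mul_neg, hjS S])).comp
          (map (s : R →+* S)) =
          (s : R →+* S).comp (eval (RingHom.id R) (-algebraMap Ω R j) (by simpa using hjS R)) := by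
        ext z
        change s z.re + s z.im * -algebraMap Ω S j = s (z.re + z.im * -algebraMap Ω R j)
        rw [map_add, map_mul, map_neg, s.commutes]
      rw [← RingHom.comp_assoc, h2, RingHom.comp_assoc, eval_neg_pair, hs₂]
      ext a
      simp
  have hsθ' : s.comp θ' = AlgHom.id Ω S := by
    refine Algebra.TensorProduct.ext (Subsingleton.elim _ _) ?_
    ext b
    have := AlgHom.congr_fun hsθ b
    have h1 : θ' (1 ⊗ₜ b) = θ b := by simp [θ']
    change s (θ' (1 ⊗ₜ b)) = inc b
    rw [h1]
    exact this
  have hinj : Function.Injective θ' :=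
    Function.LeftInverse.injective (g := s) fun x => AlgHom.congr_fun hsθ' x
  exact hinj.isDomain θ'.toRingHom

/-! ### The PAC property and the main theorem -/

/-- If `F` is a formally real pseudo real closed field, then `F(i)` is pseudo-algebraically
closed. -/
theorem isPAC {F : Type u} [Field F] [IsSemireal F] (hF : IsPRC F) : IsPAC (AdjoinI F) := by
  have : CharZero (AdjoinI F) :=
    charZero_of_injective_algebraMap (algebraMap F (AdjoinI F)).injective
  refine IsPAC.of_exists_algHom_of_formallySmooth fun A _ _ _ _ _ => ?_
  have : Nontrivial A := by
    by_contra h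
    rw [not_nontrivial_iff_subsingleton] at h
    exact not_subsingleton (AlgebraicClosure (AdjoinI F) ⊗[AdjoinI F] A) inferInstance
  obtain ⟨B, _, _, Φ, _, hΦ⟩ := exists_isWeilRestriction F A
  have := hΦ.formallySmooth
  have := hΦ.isDomain
  obtain ⟨φ⟩ := hF.exists_algHom B fun K _ _ _ => by
    let _ : Algebra (AdjoinI F) (AdjoinI K) := (map (algebraMap F K)).toAlgebra
    have : IsAlgClosed (AdjoinI K) := isAlgClosed
    obtain ⟨ψ⟩ := nonempty_algHom_of_isAlgClosed (E := AdjoinI F) (L := AdjoinI K) (A := A)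
    obtain ⟨φ, -⟩ := hΦ.exists_lift (ψ : A →+* AdjoinI K) ψ.comp_algebraMap
    exact ⟨φ⟩
  refine ⟨{ (map (φ : B →+* F)).comp Φ with commutes' := fun z => ?_ }⟩
  have h : ((map (φ : B →+* F)).comp Φ).comp (algebraMap (AdjoinI F) A) = RingHom.id _ := by
    rw [RingHom.comp_assoc, hΦ.comp_algebraMap, ← map_comp, φ.comp_algebraMap]
    rfl
  exact RingHom.congr_fun h z

end AdjoinI

theorem IsSemireal.of_algebra (F D : Type*) [Field F] [Field D] [Algebra F D] [IsSemireal D] :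
    IsSemireal F := by
  refine ⟨fun {s} hs h => ?_⟩
  have hs' : IsSumSq (algebraMap F D s) := by
    clear h
    induction hs with
    | zero => simp
    | sq_add a _ ih =>
      rw [map_add, map_mul]
      exact .sq_add _ ih
  exact IsSemireal.one_add_ne_zero hs' (by rw [← map_one (algebraMap F D), ← map_add, h, map_zero])

namespace AdjoinI

/-- `F(i)`, as a subfield of a field which contains a square root `i` of `-1`, is isomorphic to
`AdjoinI F`. -/
theorem nonempty_algEquiv_adjoin {F C : Type*} [Field F] [IsSemireal F] [Field C] [Algebra F C]
    {i : C} (hi : i ^ 2 = -1) : Nonempty (AdjoinI F ≃ₐ[F] F⟮i⟯) := by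
  let φ : AdjoinI F →ₐ[F] C :=
    { eval (algebraMap F C) i (by rw [← sq, hi]) with
      commutes' := fun x => by simp }
  have hφ (z) : φ z = algebraMap F C z.re + algebraMap F C z.im * i := rfl
  have hrange : φ.fieldRange = F⟮i⟯ := by
    apply le_antisymm
    · rintro _ ⟨z, rfl⟩
      exact add_mem (IntermediateField.algebraMap_mem _ _)
        (mul_mem (IntermediateField.algebraMap_mem _ _) (mem_adjoin_simple_self F i))
    · rw [adjoin_simple_le_iff]
      exact ⟨⟨0, 1⟩, by simp [hφ]⟩
  exact ⟨(AlgEquiv.ofInjectiveField φ).trans (IntermediateField.equivOfEq hrange)⟩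

end AdjoinI

theorem mainTheorem9 {F D C : Type*} [Field F] [Field D] [Field C]
    [Algebra F D] [Algebra D C] [Algebra F C] [IsScalarTower F D C]
    (hF : IsPRC F) [IsRealClosed D] [Algebra.IsAlgebraic F D]
    (i : C) (hi : i ^ 2 = -1) :
    PerfectField F⟮i⟯ ∧ IsPAC F⟮i⟯ ∧
      ∃ h : F⟮i⟯ ≤ D⟮i⟯.restrictScalars F, IsAlgClosure F⟮i⟯ (extendScalars h) := by
  have : IsSemireal F := IsSemireal.of_algebra F D
  have : CharZero F⟮i⟯ := charZero_of_injective_algebraMap (algebraMap F F⟮i⟯).injective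
  obtain ⟨e⟩ := AdjoinI.nonempty_algEquiv_adjoin (F := F) hi
  obtain ⟨eD⟩ := AdjoinI.nonempty_algEquiv_adjoin (F := D) hi
  have h : F⟮i⟯ ≤ D⟮i⟯.restrictScalars F := by
    rw [adjoin_simple_le_iff]
    exact mem_adjoin_simple_self D i
  refine ⟨inferInstance, (AdjoinI.isPAC hF).of_ringEquiv e.toRingEquiv, h, ?_⟩
  have hi' : IsIntegral D i := ⟨Polynomial.X ^ 2 + 1, by monicity!, by simp [hi]⟩
  have : FiniteDimensional D D⟮i⟯ := adjoin.finiteDimensional hi'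
  have h1 : IsAlgClosed D⟮i⟯ := isAlgClosed_of_odd_root_of_isSquare (R := D)
    (fun _ hf => IsRealClosed.exists_isRoot_of_odd_natDegree hf) fun x => by
      simpa using (AdjoinI.isSquare (eD.symm x)).map eD
  have h2 : Algebra.IsAlgebraic F D⟮i⟯ := Algebra.IsAlgebraic.trans F D D⟮i⟯
  -- `extendScalars h` is `D⟮i⟯` regarded over `F⟮i⟯`, so `h1` and `h2` apply to it by definition.
  have h3 : Algebra.IsAlgebraic F (extendScalars h) := h2
  exact ⟨h1, Algebra.IsAlgebraic.tower_top (K := F) F⟮i⟯⟩
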